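/- **Setting.** Fix $\alpha\in(0,2)$. For nonnegative $f,g$ write $f\asymp g$ (on a given range of the variables) if there is a constant $c\in(0,\infty)$ such that $c^{-1}<f/g<c$ on that range. Let $(E,d)$ be a metric space with a Borel measure $\mu$, and let $B(x,r)=\{y\in E: d(x,y)\le r\}$. Assume that there is a function $V:(0,\infty)\to[0,\infty)$ with $\mu(B(x,r))=V(r)$ for all $x\in E$, $r>0$. Let $p_t(x,y)$, $t>0$, be a heat kernel on $(E,\mu)$: each $p_t$ is a nonnegative $\mu\times\mu$-measurable function on $E\times E$; for all $s,t>0$ and $\mu$-almost all $x,y$, $$p_t(x,y)=p_t(y,x),\qquad \int_E p_t(x,y)\,d\mu(y)=1,\qquad p_{t+s}(x,y)=\int_E p_t(x,z)p_s(z,y)\,d\mu(z);$$ and $\int_E p_t(\cdot,y)u(y)\,d\mu(y)\to u$ in $L^2(E,\mu)$ as $t\to0^+$ for every $u\in L^2(E,\mu)$. Let $(X_t,P_x)_{t\ge0,\,x\in E}$ be an associated Markov process: a time-homogeneous Markov process in $E$ with $P_x$-almost surely right-continuous paths, $P_x[X_0=x]=1$, and $$P_x[X_t\in B]=\int_B p_t(x,y)\,d\mu(y)\qquad\text{for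 all } x\in E,\ t>0 \text{ and Borel } B\subset E.$$ For $D\subset E$ let $\tau_D=\inf\{t\ge0: X_t\notin D\}$ (with $\inf\emptyset=\infty$), and let $E_x$ denote expectation with respect to $P_x$. Assume moreover: * (volume) there exist $A\ge1$ and $c_1<1$ such that $V(r)\le c_1V(r+A)$ for all $r\ge1$, and $V(r+1)\asymp V(r)$ for $r\ge1$; * (kernel estimate) for every $M>0$ (with a constant that may depend on $M$), $$p_t(x,y)\asymp t\,d(x,y)^{-1-\alpha/2}\,V(d(x,y))^{-1}\qquad\text{for } t>0,\ d(x,y)>Mt^{2/\alpha},\ d(x,y)>1.$$ **Theorem.** There is a constant $c\in(0,\infty)$ such that for all $r>1$, all $x\in E$ and all $y\in B(x,r)$, $$E_y\,\tau_{B(x,r)}\le c\,r^{\alpha/2},$$ and $$E_x\,\tau_{B(x,r)}\asymp r^{\alpha/2}\qquad\text{for } x\in E,\ r>1 .$$ The constants do not depend on $x$, $y$, $r$. -/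

import Mathlib

open MeasureTheory ProbabilityTheory Filter Topology
open scoped NNReal ENNReal

/-- `f ≍ g` on the set `s`: there is a constant `0 < c < ∞` with `c⁻¹ < f / g < c` on `s`.
In `ℝ≥0∞` the ratio `f / g` is `0` or `∞` as soon as one of `f`, `g` is `0` or `∞`, so that the
inequalities contain the assertion that `f` and `g` are positive and finite on `s`. -/
def Comparable {ι : Type*} (s : Set ι) (f g : ι → ℝ≥0∞) : Prop :=
  ∃ c : ℝ≥0, 0 < c ∧ ∀ i ∈ s, (c : ℝ≥0∞)⁻¹ < f i / g i ∧ f i / g i < (c : ℝ≥0∞)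

/-- A heat kernel `p_t(x, y)`, `t > 0`, on a measure space `(E, μ)`: nonnegative, measurable,
symmetric, of total mass one, with the semigroup identity, and an approximation of the identity
in `L²`. The pointwise identities are required for almost all points. -/
structure IsHeatKernel {E : Type*} [MeasurableSpace E] (μ : Measure E)
    (p : ℝ≥0 → E → E → ℝ≥0) : Prop where
  aemeasurable : ∀ t : ℝ≥0, 0 < t →
    AEMeasurable (fun z : E × E => p t z.1 z.2) (μ.prod μ)
  symm : ∀ t : ℝ≥0, 0 < t → ∀ᵐ z ∂(μ.prod μ), p t z.1 z.2 = p t z.2 z.1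
  mass_one : ∀ t : ℝ≥0, 0 < t → ∀ᵐ x ∂μ, ∫⁻ y, (p t x y : ℝ≥0∞) ∂μ = 1
  semigroup : ∀ t s : ℝ≥0, 0 < t → 0 < s → ∀ᵐ z ∂(μ.prod μ),
    (p (t + s) z.1 z.2 : ℝ≥0∞) = ∫⁻ w, (p t z.1 w : ℝ≥0∞) * (p s w z.2 : ℝ≥0∞) ∂μ
  tendsto_id : ∀ u : E → ℝ, MemLp u 2 μ →
    Tendsto (fun t : ℝ≥0 => eLpNorm (fun x => (∫ y, (p t x y : ℝ) * u y ∂μ) - u x) 2 μ)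
      (𝓝[>] 0) (𝓝 0)

/-- `(X_t, P_x)` is a (time-homogeneous) Markov process with state space `E`, with almost surely
right-continuous paths, started at `x` under `P_x`, and with transition densities `p_t(x, y)` with
respect to `μ`. The Markov property is with respect to the natural filtration
`σ(X_u : u ≤ s)`; it says `P_x[X_{s+t} ∈ B | σ(X_u : u ≤ s)] = P_{X_s}[X_t ∈ B]`. -/
structure IsAssociatedProcess {E Ω : Type*} [MetricSpace E] [MeasurableSpace E]
    [MeasurableSpace Ω] (μ : Measure E) (p : ℝ≥0 → E → E → ℝ≥0)
    (X : ℝ≥0 → Ω → E) (P : Kernel E Ω) : Prop where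
  measurable : ∀ t, Measurable (X t)
  start : ∀ x, ∀ᵐ ω ∂(P x), X 0 ω = x
  right_continuous : ∀ x, ∀ᵐ ω ∂(P x), ∀ t : ℝ≥0,
    ContinuousWithinAt (fun s => X s ω) (Set.Ici t) t
  aemeasurable_density : ∀ t : ℝ≥0, 0 < t → ∀ x, AEMeasurable (p t x) μ
  transition : ∀ t : ℝ≥0, 0 < t → ∀ x, ∀ B : Set E, MeasurableSet B →
    P x (X t ⁻¹' B) = ∫⁻ y in B, (p t x y : ℝ≥0∞) ∂μ
  markov : ∀ x, ∀ s t : ℝ≥0, ∀ A : Set Ω,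
    MeasurableSet[⨆ u : Set.Iic s, MeasurableSpace.comap (X u) inferInstance] A →
    ∀ B : Set E, MeasurableSet B →
      P x (A ∩ X (s + t) ⁻¹' B) = ∫⁻ ω in A, P (X s ω) (X t ⁻¹' B) ∂(P x)

/-- The exit time `τ_D = inf {t ≥ 0 : X_t ∉ D}`, equal to `∞` if `X` never leaves `D`. -/
noncomputable def exitTime {E Ω : Type*} (X : ℝ≥0 → Ω → E) (D : Set E) (ω : Ω) : ℝ≥0∞ :=
  ⨅ (t : ℝ≥0) (_ : X t ω ∉ D), (t : ℝ≥0∞)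

/-! Upper bound. Volume growth gives the annulus `a < d ≤ a + A` a fixed proportion of `V (a + A)`,
so at time `T = r ^ (α / 2)` it carries probability at least of order `T * a ^ (-1 - α / 2)`. About
`r` such annuli at distances between `2r` and a multiple of `r` give a probability `δ > 0`,
independent of `r` and of the starting point, of having moved farther than `2r`
(`le_measure_dist_gt`). Such a move leaves every ball of radius `r`, so repeated trials at times `T,
2T, ...` yield `T / δ` (`lintegral_exitTime_le`).

Lower bound, `r > 2`. Summing the upper kernel bound over unit shells gives tails `C * s * R ^ (-α /
2)` for `R ≥ 1` (`measure_dist_gt_le`). A path that exits either ends farther than `r / 2` from `x`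
or moves back by more than `r / 2`. Hence the probability of exit before `ε * r ^ (α / 2)` is at
most `1 / 2`.

Lower bound, `1 < r ≤ 2`. Here `r / 2 ≤ 1`, where no kernel bound is available. Stop instead at a
tiny time `δ` with `X_δ` within `r - 1` of `x`; exit positions are then at distance more than `1`
from `X_δ`. If `g` is the density of `X_T` on this event, symmetry and the semigroup identity turn
the expectation of `g(X_T)` after an exit into an average of the kernel at distances exceeding `1`,
which is at most a small `κ`. So after an exit `g(X_T)` is rarely large, whereas `g(X_T)` is rarely
small in a ball of bounded volume (`measure_exists_notMem_closedBall_le_of_kernel_le`). The choice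
of `δ` depends on `x` and `r`, but the resulting bound does not. -/

namespace IsAssociatedProcess

/-! ### Markov property and first exit along finite sets of times. -/

theorem measurableSet_past {E Ω : Type*} [MeasurableSpace E] {X : ℝ≥0 → Ω → E}
    {s t : ℝ≥0} (hst : s ≤ t) {B : Set E} (hB : MeasurableSet B) :
    MeasurableSet[⨆ u : Set.Iic t, MeasurableSpace.comap (X u) inferInstance] (X s ⁻¹' B) :=
  le_iSup (fun u : Set.Iic t => MeasurableSpace.comap (X u) inferInstance) ⟨s, hst⟩ _ ⟨B, hB, rfl⟩

variable {E Ω : Type*} [MetricSpace E] [MeasurableSpace E] [MeasurableSpace Ω] {μ : Measure E}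
  {p : ℝ≥0 → E → E → ℝ≥0} {X : ℝ≥0 → Ω → E} {P : Kernel E Ω}

/-- The law of `X_t` under `P_x` has density `p_t(x, ·)`. -/
theorem map_eq_withDensity (hX : IsAssociatedProcess μ p X P) {t : ℝ≥0} (ht : 0 < t) (x : E) :
    (P x).map (X t) = μ.withDensity (fun y => (p t x y : ℝ≥0∞)) := by
  ext B hB
  rw [Measure.map_apply (hX.measurable t) hB, hX.transition t ht x B hB, withDensity_apply _ hB]

theorem ae_comp (hX : IsAssociatedProcess μ p X P) {t : ℝ≥0} (ht : 0 < t) (x : E)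
    {q : E → Prop} (hq : ∀ᵐ z ∂μ, q z) : ∀ᵐ ω ∂(P x), q (X t ω) := by
  have h : (P x).map (X t) ≪ μ := by
    rw [hX.map_eq_withDensity ht x]
    exact withDensity_absolutelyContinuous _ _
  exact ae_of_ae_map (hX.measurable t).aemeasurable (h.ae_le hq)

/-- The Markov property for nonnegative measurable functions of the state. -/
theorem setLIntegral_comp_add (hX : IsAssociatedProcess μ p X P) (x : E) (s t : ℝ≥0)
    {A : Set Ω} (hA : MeasurableSet[⨆ u : Set.Iic s, MeasurableSpace.comap (X u) inferInstance] A)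
    {h : E → ℝ≥0∞} (hh : Measurable h) :
    ∫⁻ ω in A, h (X (s + t) ω) ∂(P x) =
      ∫⁻ ω in A, ∫⁻ ω', h (X t ω') ∂(P (X s ω)) ∂(P x) := by
  have key : ((P x).restrict A).map (X (s + t)) =
      (((P x).restrict A).map (X s)).bind (P.map (X t)) := by
    ext B hB
    rw [Measure.map_apply (hX.measurable _) hB, Measure.restrict_apply (hX.measurable _ hB),
      Set.inter_comm, hX.markov x s t A hA B hB, Measure.bind_apply hB (Kernel.aemeasurable _),
      lintegral_map (Kernel.measurable_coe _ hB) (hX.measurable s)]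
    refine lintegral_congr fun ω => ?_
    rw [Kernel.map_apply' _ (hX.measurable t) _ hB]
  rw [← lintegral_map hh (hX.measurable _), key, Measure.lintegral_bind (Kernel.aemeasurable _)
    hh.aemeasurable, lintegral_map (hh.lintegral_kernel) (hX.measurable s)]
  refine lintegral_congr fun ω => ?_
  rw [Kernel.map_apply _ (hX.measurable t), lintegral_map hh (hX.measurable t)]

/-- Decomposition at the first time in a finite set of times at which the process is not in `D`:
if the expectation of `h(X_T)` is at most `k` from each of these times on, then it is at most `k`
conditionally on leaving `D`. -/
theorem setLIntegral_exit_le (hX : IsAssociatedProcess μ p X P) (x : E) {D : Set E}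
    (hD : MeasurableSet D) {h : E → ℝ≥0∞} (hh : Measurable h) (k : ℝ≥0∞) {G : Set Ω} (T : ℝ≥0)
    (F : Finset ℝ≥0)
    (hG : ∀ t ∈ F,
      MeasurableSet[⨆ u : Set.Iic t, MeasurableSpace.comap (X u) inferInstance] G)
    (hG' : MeasurableSet G) (hF : ∀ t ∈ F, t ≤ T)
    (hk : ∀ t ∈ F, ∀ᵐ ω ∂(P x), ω ∈ G → X t ω ∉ D →
      ∫⁻ ω', h (X (T - t) ω') ∂(P (X t ω)) ≤ k) :
    ∫⁻ ω in G ∩ {ω | ∃ t ∈ F, X t ω ∉ D}, h (X T ω) ∂(P x) ≤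
      k * P x (G ∩ {ω | ∃ t ∈ F, X t ω ∉ D}) := by
  induction F using Finset.induction_on_max with
  | empty => simp
  | insert t F hlt ih =>
    -- Since `t` exceeds all of `F`, the new piece is the event of a first exit at `t`; it belongs
    -- to the past of `t`, so the Markov property applies there.
    have hsplit : G ∩ {ω | ∃ s ∈ insert t F, X s ω ∉ D} =
        (G ∩ {ω | ∃ s ∈ F, X s ω ∉ D}) ∪
          (G ∩ ((⋂ s ∈ F, X s ⁻¹' D) ∩ X t ⁻¹' Dᶜ)) := by
      ext ω
      simp only [Finset.mem_insert, exists_eq_or_imp, Set.mem_inter_iff, Set.mem_ofPred_eq,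
        Set.mem_union, Set.mem_iInter, Set.mem_preimage, Set.mem_compl_iff]
      by_cases hc : ∃ s ∈ F, X s ω ∉ D
      · simp [hc]
      · have hc' := hc
        push Not at hc'
        simp only [hc, and_false, false_or, or_false]
        tauto
    have hdisj : Disjoint (G ∩ {ω | ∃ s ∈ F, X s ω ∉ D})
        (G ∩ ((⋂ s ∈ F, X s ⁻¹' D) ∩ X t ⁻¹' Dᶜ)) := by
      rw [Set.disjoint_left]
      rintro ω ⟨-, s, hs, h1⟩ ⟨-, h2, -⟩
      exact h1 (Set.mem_iInter₂.1 h2 s hs)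
    have hmeas : MeasurableSet[⨆ u : Set.Iic t, MeasurableSpace.comap (X u) inferInstance]
        (G ∩ ((⋂ s ∈ F, X s ⁻¹' D) ∩ X t ⁻¹' Dᶜ)) := by
      refine (hG t (Finset.mem_insert_self _ _)).inter (MeasurableSet.inter ?_ ?_)
      · exact Finset.measurableSet_biInter F fun s hs => measurableSet_past (hlt s hs).le hD
      · exact measurableSet_past le_rfl hD.compl
    have hmeas' : MeasurableSet (G ∩ ((⋂ s ∈ F, X s ⁻¹' D) ∩ X t ⁻¹' Dᶜ)) :=
      hG'.inter ((Finset.measurableSet_biInter F fun s _ => hX.measurable s hD).inter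
        (hX.measurable t hD.compl))
    rw [hsplit, lintegral_union hmeas' hdisj, measure_union hdisj hmeas', mul_add]
    refine add_le_add (ih (fun s hs => hG s (Finset.mem_insert_of_mem hs))
      (fun s hs => hF s (Finset.mem_insert_of_mem hs))
      (fun s hs => hk s (Finset.mem_insert_of_mem hs))) ?_
    have hT : T = t + (T - t) := (add_tsub_cancel_of_le (hF t (Finset.mem_insert_self _ _))).symm
    have hM := hX.setLIntegral_comp_add x t (T - t) hmeas hh
    rw [← hT] at hM
    rw [hM, ← setLIntegral_const]
    refine lintegral_mono_ae ((ae_restrict_iff' hmeas').2 ?_)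
    filter_upwards [hk t (Finset.mem_insert_self _ _)] with ω hω hm
    exact hω hm.1 hm.2.2

/-- A bound for the exit probability along finite sets of times bounds the probability to exit
a closed set before `T`. -/
theorem exitTime_lt_le (hX : IsAssociatedProcess μ p X P) (x : E) {D : Set E}
    (hD : IsClosed D) (T : ℝ≥0) (b : ℝ≥0∞)
    (hb : ∀ F : Finset ℝ≥0, (∀ t ∈ F, 0 < t ∧ t < T) → P x {ω | ∃ t ∈ F, X t ω ∉ D} ≤ b) :
    P x {ω | exitTime X D ω < T} ≤ b := by
  obtain ⟨S, hSc, hSd⟩ := TopologicalSpace.exists_countable_dense ℝ≥0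
  let S' : Set ℝ≥0 := S ∩ Set.Ioo 0 T
  have hS'c : S'.Countable := hSc.mono Set.inter_subset_left
  have hsub : ∀ᵐ ω ∂(P x), exitTime X D ω < T → ∃ t ∈ S', X t ω ∉ D := by
    filter_upwards [hX.right_continuous x] with ω hω hlt
    simp only [exitTime, iInf_lt_iff] at hlt
    obtain ⟨t, htD, htT⟩ := hlt
    have htT : t < T := by exact_mod_cast htT
    -- The complement of `D` is open, so the path stays outside `D` for a short time after `t` and
    -- is seen there at a strictly positive time of the dense set.
    have h1 : ∀ᶠ s in 𝓝[Set.Ici t] t, X s ω ∈ Dᶜ :=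
      (hω t).eventually (hD.isOpen_compl.mem_nhds htD)
    obtain ⟨v, hv, hv'⟩ := (mem_nhdsGE_iff_exists_Ico_subset' htT).1 h1
    obtain ⟨s, hs, hsS⟩ := hSd.exists_mem_open (isOpen_Ioo (a := t) (b := min v T))
      (Set.nonempty_Ioo.2 (lt_min hv htT))
    exact ⟨s, ⟨hs, lt_of_le_of_lt bot_le hsS.1, hsS.2.trans_le (min_le_right _ _)⟩,
      hv' ⟨hsS.1.le, hsS.2.trans_le (min_le_left _ _)⟩⟩
  refine (measure_mono_ae (t := {ω | ∃ t ∈ S', X t ω ∉ D}) hsub).trans ?_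
  have hU : {ω | ∃ t ∈ S', X t ω ∉ D} =
      ⋃ F : Finset S', {ω | ∃ t ∈ F.map (Function.Embedding.subtype _), X t ω ∉ D} := by
    ext ω
    simp only [Set.mem_ofPred_eq, Set.mem_iUnion]
    constructor
    · rintro ⟨t, ht, h⟩
      exact ⟨{⟨t, ht⟩}, t, by simp, h⟩
    · rintro ⟨F, t, ht, h⟩
      obtain ⟨s, -, rfl⟩ := Finset.mem_map.1 ht
      exact ⟨s, s.2, h⟩
  have hdir : Directed (· ⊆ ·)
      fun F : Finset S' => {ω | ∃ t ∈ F.map (Function.Embedding.subtype _), X t ω ∉ D} :=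
    Monotone.directed_le fun F F' hFF' ω ⟨t, ht, h⟩ => ⟨t, Finset.map_subset_map.2 hFF' ht, h⟩
  have := hS'c.to_subtype
  rw [hU, hdir.measure_iUnion]
  refine iSup_le fun F => hb _ fun t ht => ?_
  obtain ⟨s, -, rfl⟩ := Finset.mem_map.1 ht
  exact s.2.2

end IsAssociatedProcess

/-! ### Markov's inequality and sums of powers. -/

theorem le_lintegral_of_measure_lt {Ω : Type*} [MeasurableSpace Ω] (m : Measure Ω)
    [IsProbabilityMeasure m] (f : Ω → ℝ≥0∞) (T : ℝ≥0∞) (h : m {ω | f ω < T} ≤ 2⁻¹) :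
    T * 2⁻¹ ≤ ∫⁻ ω, f ω ∂m := by
  -- Measurability of `f` (later an exit time) is not assumed, so the event is replaced by a
  -- measurable hull of equal measure.
  have hS : MeasurableSet (toMeasurable m {ω | f ω < T})ᶜ := (measurableSet_toMeasurable _ _).compl
  calc T * 2⁻¹ ≤ T * m (toMeasurable m {ω | f ω < T})ᶜ := by
        gcongr
        rw [prob_compl_eq_one_sub (measurableSet_toMeasurable _ _), measure_toMeasurable]
        calc (2⁻¹ : ℝ≥0∞) = 1 - 2⁻¹ := by rw [ENNReal.one_sub_inv_two]
          _ ≤ _ := by gcongr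
    _ = ∫⁻ ω in (toMeasurable m {ω | f ω < T})ᶜ, T ∂m := by rw [setLIntegral_const]
    _ ≤ ∫⁻ ω in (toMeasurable m {ω | f ω < T})ᶜ, f ω ∂m := by
        refine setLIntegral_mono' hS fun ω hω => ?_
        by_contra hlt
        exact hω (subset_toMeasurable _ _ (not_le.1 hlt))
    _ ≤ _ := setLIntegral_le_lintegral _ _

/-- Bernoulli's inequality for `(a / (a + 1)) ^ (-β)`, from `log u ≤ u - 1` and `1 + v ≤ exp v`. The
factor `2 ^ (-1 - β)` pays for `a + 1 ≤ 2 * a`. -/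
theorem Real.rpow_neg_sub_rpow_neg_ge {β a : ℝ} (hβ : 0 < β) (ha : 1 ≤ a) :
    β * 2 ^ (-1 - β) * a ^ (-1 - β) ≤ a ^ (-β) - (a + 1) ^ (-β) := by
  have ha0 : 0 < a := by linarith
  have h1 : (2 : ℝ) ^ (-1 - β) * a ^ (-1 - β) ≤ (a + 1) ^ (-1 - β) := by
    rw [← Real.mul_rpow (by norm_num) ha0.le]
    exact Real.rpow_le_rpow_of_nonpos (by positivity) (by linarith) (by linarith)
  have h2 : (a + 1) ^ (-β) * (1 + β / (a + 1)) ≤ a ^ (-β) := by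
    have h3 : 1 + β / (a + 1) ≤ (a / (a + 1)) ^ (-β) := by
      have hq : 0 < a / (a + 1) := by positivity
      rw [Real.rpow_def_of_pos hq]
      have hl := Real.log_le_sub_one_of_pos hq
      have he := Real.add_one_le_exp (Real.log (a / (a + 1)) * -β)
      have : a / (a + 1) - 1 = -(1 / (a + 1)) := by field_simp; ring
      have h4 : β * Real.log (a / (a + 1)) ≤ β * -(1 / (a + 1)) := by
        rw [this] at hl; gcongr
      have h5 : β * (1 / (a + 1)) = β / (a + 1) := by ring
      nlinarith
    calc (a + 1) ^ (-β) * (1 + β / (a + 1)) ≤ (a + 1) ^ (-β) * (a / (a + 1)) ^ (-β) := by gcongr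
      _ = a ^ (-β) := by
        rw [← Real.mul_rpow (by positivity) (by positivity)]; congr 1; field_simp
  have h6 : (a + 1) ^ (-1 - β) = (a + 1) ^ (-β) / (a + 1) := by
    rw [show -1 - β = -β - 1 by ring, Real.rpow_sub_one (by positivity)]
  calc β * 2 ^ (-1 - β) * a ^ (-1 - β) = β * (2 ^ (-1 - β) * a ^ (-1 - β)) := by ring
    _ ≤ β * (a + 1) ^ (-1 - β) := by gcongr
    _ = (a + 1) ^ (-β) * (1 + β / (a + 1)) - (a + 1) ^ (-β) := by rw [h6]; ring
    _ ≤ _ := by linarith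

/-- The preceding lower bound on increments telescopes. -/
theorem Real.sum_range_rpow_neg_le {β R : ℝ} (hβ : 0 < β) (hR : 1 ≤ R) (n : ℕ) :
    ∑ k ∈ Finset.range n, (R + k) ^ (-1 - β) ≤ (β * 2 ^ (-1 - β))⁻¹ * R ^ (-β) := by
  have hc : 0 < β * (2 : ℝ) ^ (-1 - β) := by positivity
  have key : (β * 2 ^ (-1 - β)) * ∑ k ∈ Finset.range n, (R + k) ^ (-1 - β) ≤
      R ^ (-β) - (R + n) ^ (-β) := by
    induction n with
    | zero => simp
    | succ n ih =>
      have hn : (0 : ℝ) ≤ n := n.cast_nonneg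
      have := Real.rpow_neg_sub_rpow_neg_ge hβ (a := R + n) (by linarith)
      rw [Finset.sum_range_succ, mul_add]
      push_cast
      rw [← add_assoc]
      linarith
  have h0 : 0 ≤ (R + n) ^ (-β) := Real.rpow_nonneg (by positivity) _
  rw [inv_mul_eq_div, le_div_iff₀ hc]
  linarith

/-! ### Tails of the position: upper and lower bounds from the kernel estimate. -/

namespace IsAssociatedProcess

variable {E Ω : Type*} [MetricSpace E] [MeasurableSpace E] [BorelSpace E] [MeasurableSpace Ω]
  {μ : Measure E} {p : ℝ≥0 → E → E → ℝ≥0} {X : ℝ≥0 → Ω → E} {P : Kernel E Ω}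
  {V : ℝ → ℝ≥0} {α K : ℝ}

/-- The jump-type upper kernel bound and the volume doubling for unit increments give polynomial
tails of the position. -/
theorem measure_dist_gt_le [IsMarkovKernel P] (hX : IsAssociatedProcess μ p X P) (hα : 0 < α)
    (hV : ∀ x : E, ∀ r : ℝ, 0 < r → μ (Metric.closedBall x r) = (V r : ℝ≥0∞))
    (hpos : ∀ r, 1 ≤ r → 0 < V r) (hmono : ∀ r s, 0 < r → r ≤ s → V r ≤ V s)
    {Cv : ℝ} (hCv : 0 < Cv) (hdoub : ∀ r, 1 ≤ r → (V (r + 1) : ℝ) ≤ Cv * V r) (hK : 0 < K)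
    (hup : ∀ t : ℝ≥0, 0 < t → ∀ y z : E, (t : ℝ) ^ (2 / α) < dist y z → 1 < dist y z →
      (p t y z : ℝ≥0∞) ≤ ENNReal.ofReal
        (K * ((t : ℝ) * dist y z ^ (-1 - α / 2) * (V (dist y z) : ℝ)⁻¹))) :
    ∃ C : ℝ, 0 < C ∧ ∀ (y : E) (s : ℝ≥0) (R : ℝ), 0 < s → 1 ≤ R →
      P y {ω | R < dist y (X s ω)} ≤ ENNReal.ofReal (C * s * R ^ (-(α / 2))) := by
  have hβ : 0 < α / 2 := by positivity
  set C₀ : ℝ := K * Cv * (α / 2 * 2 ^ (-1 - α / 2))⁻¹ with hC₀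
  have hC₀pos : 0 < C₀ := by positivity
  refine ⟨C₀ + 1, by positivity, fun y s R hs hR => ?_⟩
  have hR0 : 0 < R := by linarith
  have hs' : (0 : ℝ) < s := hs
  -- If this fails, then `s * R ^ (-(α / 2)) ≥ 1` and the bound is trivial; the `+ 1` in the
  -- constant serves that case.
  by_cases hsR : (s : ℝ) ^ (2 / α) ≤ R
  · have hset : MeasurableSet {z : E | R < dist y z} :=
      (isOpen_lt continuous_const (continuous_const.dist continuous_id)).measurableSet
    have hcover : {z : E | R < dist y z} ⊆
        ⋃ k : ℕ, {z : E | R + k < dist y z ∧ dist y z ≤ R + k + 1} := by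
      intro z hz
      have hz : R < dist y z := hz
      obtain ⟨m, hm⟩ := exists_nat_ge (dist y z - R)
      have hex : ∃ m : ℕ, dist y z ≤ R + m := ⟨m, by linarith⟩
      classical
      have hf := Nat.find_spec hex
      have hne : Nat.find hex ≠ 0 := by
        intro h0; rw [h0] at hf; simp at hf; linarith
      obtain ⟨k, hk⟩ := Nat.exists_eq_succ_of_ne_zero hne
      have hlt := Nat.find_min hex (m := k) (by omega)
      rw [hk] at hf
      push_cast at hf
      exact Set.mem_iUnion.2 ⟨k, not_le.1 hlt, by linarith⟩
    -- The shell has volume at most `V (R + k + 1) ≤ Cv * V (R + k)`, which cancels the volume in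
    -- the kernel bound.
    have hshell : ∀ k : ℕ, ∫⁻ z in {z : E | R + k < dist y z ∧ dist y z ≤ R + k + 1},
        (p s y z : ℝ≥0∞) ∂μ ≤ ENNReal.ofReal (K * Cv * s * (R + k) ^ (-1 - α / 2)) := by
      intro k
      have hk : (0 : ℝ) ≤ k := k.cast_nonneg
      have hVk : (0 : ℝ) < V (R + k) := by exact_mod_cast hpos _ (by linarith)
      calc ∫⁻ z in {z : E | R + k < dist y z ∧ dist y z ≤ R + k + 1}, (p s y z : ℝ≥0∞) ∂μ
          ≤ ∫⁻ z in {z : E | R + k < dist y z ∧ dist y z ≤ R + k + 1},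
              ENNReal.ofReal (K * (s * (R + k) ^ (-1 - α / 2) * (V (R + k) : ℝ)⁻¹)) ∂μ := by
            refine setLIntegral_mono measurable_const fun z hz => ?_
            have h1 : R + k < dist y z := hz.1
            refine (hup s hs y z (by linarith) (by linarith)).trans (ENNReal.ofReal_le_ofReal ?_)
            have h2 : dist y z ^ (-1 - α / 2) ≤ (R + k) ^ (-1 - α / 2) :=
              Real.rpow_le_rpow_of_nonpos (by linarith) h1.le (by linarith)
            have h3 : (V (R + k) : ℝ) ≤ V (dist y z) := by
              exact_mod_cast hmono _ _ (by linarith) h1.le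
            gcongr
        _ = ENNReal.ofReal (K * (s * (R + k) ^ (-1 - α / 2) * (V (R + k) : ℝ)⁻¹)) *
              μ {z : E | R + k < dist y z ∧ dist y z ≤ R + k + 1} := setLIntegral_const _ _
        _ ≤ ENNReal.ofReal (K * (s * (R + k) ^ (-1 - α / 2) * (V (R + k) : ℝ)⁻¹)) *
              ENNReal.ofReal (Cv * V (R + k)) := by
            gcongr
            calc μ {z : E | R + k < dist y z ∧ dist y z ≤ R + k + 1}
                ≤ μ (Metric.closedBall y (R + k + 1)) := measure_mono fun z hz => by
                  rw [Metric.mem_closedBall, dist_comm]; exact hz.2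
              _ = ENNReal.ofReal (V (R + k + 1)) := by
                  rw [hV _ _ (by linarith), ENNReal.ofReal_coe_nnreal]
              _ ≤ _ := ENNReal.ofReal_le_ofReal (hdoub _ (by linarith))
        _ = _ := by
            rw [← ENNReal.ofReal_mul (by positivity)]
            congr 1
            field_simp
    calc P y {ω | R < dist y (X s ω)} = ∫⁻ z in {z : E | R < dist y z}, (p s y z : ℝ≥0∞) ∂μ :=
          hX.transition s hs y _ hset
      _ ≤ ∫⁻ z in ⋃ k : ℕ, {z : E | R + k < dist y z ∧ dist y z ≤ R + k + 1},
            (p s y z : ℝ≥0∞) ∂μ := lintegral_mono_set hcover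
      _ ≤ ∑' k : ℕ, ∫⁻ z in {z : E | R + k < dist y z ∧ dist y z ≤ R + k + 1},
            (p s y z : ℝ≥0∞) ∂μ := lintegral_iUnion_le _ _
      _ ≤ ∑' k : ℕ, ENNReal.ofReal (K * Cv * s * (R + k) ^ (-1 - α / 2)) :=
          ENNReal.tsum_le_tsum hshell
      _ ≤ ENNReal.ofReal (C₀ * s * R ^ (-(α / 2))) := by
          refine ENNReal.tsum_le_of_sum_range_le fun n => ?_
          rw [← ENNReal.ofReal_sum_of_nonneg fun k _ => by positivity, ← Finset.mul_sum]
          refine ENNReal.ofReal_le_ofReal ?_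
          calc K * Cv * s * ∑ k ∈ Finset.range n, (R + k) ^ (-1 - α / 2)
              ≤ K * Cv * s * ((α / 2 * 2 ^ (-1 - α / 2))⁻¹ * R ^ (-(α / 2))) := by
                gcongr; exact Real.sum_range_rpow_neg_le hβ hR n
            _ = _ := by rw [hC₀]; ring
      _ ≤ _ := by gcongr; linarith
  · refine prob_le_one.trans ?_
    rw [← ENNReal.ofReal_one]
    refine ENNReal.ofReal_le_ofReal ?_
    have h1 : R ^ (α / 2) ≤ s := by
      calc R ^ (α / 2) ≤ ((s : ℝ) ^ (2 / α)) ^ (α / 2) := by gcongr; exact (not_le.1 hsR).le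
        _ = s := by
          rw [← Real.rpow_mul hs'.le, show 2 / α * (α / 2) = 1 by field_simp, Real.rpow_one]
    have h2 : R ^ (α / 2) * R ^ (-(α / 2)) = 1 := by
      rw [← Real.rpow_add hR0]; simp
    have h3 : 0 < R ^ (-(α / 2)) := by positivity
    calc (1 : ℝ) = R ^ (α / 2) * R ^ (-(α / 2)) := h2.symm
      _ ≤ s * R ^ (-(α / 2)) := by gcongr
      _ ≤ _ := by
        rw [mul_assoc]
        exact le_mul_of_one_le_left (by positivity) (by linarith)

/-- The jump-type lower kernel bound and exponential volume growth: by time `r ^ (α / 2)` the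
process has moved farther than `2 * r` with probability bounded below. -/
theorem le_measure_dist_gt (hX : IsAssociatedProcess μ p X P) (hα : 0 < α)
    (hV : ∀ x : E, ∀ r : ℝ, 0 < r → μ (Metric.closedBall x r) = (V r : ℝ≥0∞))
    (hpos : ∀ r, 1 ≤ r → 0 < V r) (hmono : ∀ r s, 0 < r → r ≤ s → V r ≤ V s)
    {A c₁ : ℝ} (hA : 1 ≤ A) (hc₁ : c₁ < 1)
    (hgrow : ∀ r : ℝ, 1 ≤ r → (V r : ℝ) ≤ c₁ * (V (r + A) : ℝ)) (hK : 0 < K)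
    (hlow : ∀ t : ℝ≥0, 0 < t → ∀ y z : E, (t : ℝ) ^ (2 / α) < dist y z → 1 < dist y z →
      ENNReal.ofReal (K * ((t : ℝ) * dist y z ^ (-1 - α / 2) * (V (dist y z) : ℝ)⁻¹)) ≤
        (p t y z : ℝ≥0∞)) :
    ∃ δ : ℝ, 0 < δ ∧ ∀ (y : E) (T : ℝ≥0) (r : ℝ), 1 < r → (T : ℝ) = r ^ (α / 2) →
      ENNReal.ofReal δ ≤ P y {ω | 2 * r < dist y (X T ω)} := by
  refine ⟨K * (1 - c₁) * (2 + 2 * A) ^ (-1 - α / 2), ?_, fun y T r hr hT => ?_⟩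
  · have : 0 < 1 - c₁ := by linarith
    positivity
  have hr0 : 0 < r := by linarith
  have hA0 : 0 < A := by linarith
  have hc : 0 < 1 - c₁ := by linarith
  have hT0 : (0 : ℝ) < T := by rw [hT]; positivity
  have hT0' : 0 < T := hT0
  have hTr : (T : ℝ) ^ (2 / α) = r := by
    rw [hT, ← Real.rpow_mul hr0.le, show α / 2 * (2 / α) = 1 by field_simp, Real.rpow_one]
  have hmeas : ∀ a b : ℝ, MeasurableSet {z : E | a < dist y z ∧ dist y z ≤ b} := fun a b =>
    (isOpen_lt continuous_const (continuous_const.dist continuous_id)).measurableSet.inter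
      (isClosed_le (continuous_const.dist continuous_id) continuous_const).measurableSet
  -- A common outer radius `b` gives all annuli the same lower bound, so that their number can
  -- simply be multiplied in.
  have hshell : ∀ a b : ℝ, 2 * r ≤ a → a + A ≤ b →
      ENNReal.ofReal (K * (T * b ^ (-1 - α / 2)) * (1 - c₁)) ≤
        P y {ω | a < dist y (X T ω) ∧ dist y (X T ω) ≤ a + A} := by
    intro a b ha hb
    have hVa : (0 : ℝ) < V (a + A) := by exact_mod_cast hpos _ (by linarith)
    calc ENNReal.ofReal (K * (T * b ^ (-1 - α / 2)) * (1 - c₁))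
        = ENNReal.ofReal (K * (T * b ^ (-1 - α / 2) * (V (a + A) : ℝ)⁻¹)) *
            ENNReal.ofReal ((1 - c₁) * V (a + A)) := by
          have hb0 : 0 < b := by linarith
          rw [← ENNReal.ofReal_mul (by positivity)]
          congr 1
          field_simp
      _ ≤ ENNReal.ofReal (K * (T * b ^ (-1 - α / 2) * (V (a + A) : ℝ)⁻¹)) *
            μ {z : E | a < dist y z ∧ dist y z ≤ a + A} := by
          gcongr
          have hd : {z : E | a < dist y z ∧ dist y z ≤ a + A} =
              Metric.closedBall y (a + A) \ Metric.closedBall y a := by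
            ext z
            simp only [Set.mem_ofPred_eq, Set.mem_sdiff, Metric.mem_closedBall, not_le, dist_comm y]
            exact and_comm
          rw [hd, measure_sdiff (Metric.closedBall_subset_closedBall (by linarith))
            Metric.isClosed_closedBall.nullMeasurableSet (by rw [hV _ _ (by linarith)]; simp),
            hV _ _ (by linarith), hV _ _ (by linarith), ← ENNReal.ofReal_coe_nnreal,
            ← ENNReal.ofReal_coe_nnreal (p := V a), ← ENNReal.ofReal_sub _ (by positivity)]
          refine ENNReal.ofReal_le_ofReal ?_
          have := hgrow a (by linarith)
          linarith
      _ = ∫⁻ z in {z : E | a < dist y z ∧ dist y z ≤ a + A},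
            ENNReal.ofReal (K * (T * b ^ (-1 - α / 2) * (V (a + A) : ℝ)⁻¹)) ∂μ :=
          (setLIntegral_const _ _).symm
      _ ≤ ∫⁻ z in {z : E | a < dist y z ∧ dist y z ≤ a + A}, (p T y z : ℝ≥0∞) ∂μ := by
          refine setLIntegral_mono' (hmeas _ _) fun z hz => ?_
          have h1 : a < dist y z := hz.1
          have h2 : dist y z ≤ a + A := hz.2
          refine le_trans (ENNReal.ofReal_le_ofReal ?_)
            (hlow T hT0' y z (by rw [hTr]; linarith) (by linarith))
          have h3 : b ^ (-1 - α / 2) ≤ dist y z ^ (-1 - α / 2) :=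
            Real.rpow_le_rpow_of_nonpos (by linarith) (h2.trans hb) (by linarith)
          have h4 : (V (dist y z) : ℝ) ≤ V (a + A) := by
            exact_mod_cast hmono _ _ (by linarith) h2
          have h5 : (0 : ℝ) < V (dist y z) := by exact_mod_cast hpos _ (by linarith)
          gcongr
      _ = _ := (hX.transition T hT0' y _ (hmeas _ _)).symm
  have hiter : ∀ (b : ℝ) (n : ℕ), 2 * r + n * A ≤ b →
      ENNReal.ofReal (n * (K * (T * b ^ (-1 - α / 2)) * (1 - c₁))) ≤
        P y {ω | 2 * r < dist y (X T ω) ∧ dist y (X T ω) ≤ 2 * r + n * A} := by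
    intro b n
    induction n with
    | zero => simp
    | succ n ih =>
      intro hb
      push_cast at hb
      have hnA : 0 ≤ (n : ℝ) * A := by positivity
      have hb0 : 0 < b := by linarith
      have hsub : {ω | 2 * r < dist y (X T ω) ∧ dist y (X T ω) ≤ 2 * r + n * A} ∪
          {ω | 2 * r + n * A < dist y (X T ω) ∧ dist y (X T ω) ≤ 2 * r + n * A + A} ⊆
          {ω | 2 * r < dist y (X T ω) ∧ dist y (X T ω) ≤ 2 * r + (n + 1 : ℕ) * A} := by
        push_cast
        rintro ω (⟨h1, h2⟩ | ⟨h1, h2⟩)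
        · exact ⟨h1, by linarith⟩
        · exact ⟨by linarith, by linarith⟩
      refine le_trans ?_ (measure_mono hsub)
      rw [measure_union]
      · rw [show ((n + 1 : ℕ) : ℝ) * (K * (T * b ^ (-1 - α / 2)) * (1 - c₁)) =
          n * (K * (T * b ^ (-1 - α / 2)) * (1 - c₁)) + K * (T * b ^ (-1 - α / 2)) * (1 - c₁) by
            push_cast; ring, ENNReal.ofReal_add (by positivity) (by positivity)]
        exact add_le_add (ih (by linarith)) (hshell _ _ (by linarith) (by linarith))
      · rw [Set.disjoint_left]
        rintro ω ⟨-, h1⟩ ⟨h2, -⟩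
        exact absurd h1 (not_le.2 h2)
      · exact hX.measurable T (hmeas _ _)
  obtain hn : r ≤ ⌈r⌉₊ := Nat.le_ceil r
  have hn' : (⌈r⌉₊ : ℝ) ≤ 2 * r := by
    have := Nat.ceil_lt_add_one hr0.le
    linarith
  -- With `⌈r⌉₊ ≤ 2 * r` annuli the outer radius is at most `r * (2 + 2 * A)`, and the powers of `r`
  -- cancel: `1 + α / 2 + (-1 - α / 2) = 0`.
  refine le_trans ?_ ((hiter (2 * r + 2 * r * A) ⌈r⌉₊ (by gcongr)).trans
    (measure_mono fun ω hω => hω.1))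
  refine ENNReal.ofReal_le_ofReal ?_
  have h1 : 2 * r + 2 * r * A = r * (2 + 2 * A) := by ring
  rw [h1, Real.mul_rpow hr0.le (by positivity), hT]
  have h2 : r * (r ^ (α / 2) * r ^ (-1 - α / 2)) = 1 := by
    rw [← Real.rpow_add hr0, show α / 2 + (-1 - α / 2) = -1 by ring, Real.rpow_neg_one]
    field_simp
  calc K * (1 - c₁) * (2 + 2 * A) ^ (-1 - α / 2)
      = r * (r ^ (α / 2) * r ^ (-1 - α / 2)) * (K * (1 - c₁) * (2 + 2 * A) ^ (-1 - α / 2)) := by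
        rw [h2, one_mul]
    _ = r * (K * (r ^ (α / 2) * (r ^ (-1 - α / 2) * (2 + 2 * A) ^ (-1 - α / 2))) * (1 - c₁)) := by
        ring
    _ ≤ _ := by gcongr

end IsAssociatedProcess

/-! ### Repeated trials, the maximal inequality and small times. -/

namespace IsAssociatedProcess

variable {E Ω : Type*} [MetricSpace E] [MeasurableSpace E] [MeasurableSpace Ω]
  {μ : Measure E} {p : ℝ≥0 → E → E → ℝ≥0} {X : ℝ≥0 → Ω → E} {P : Kernel E Ω}

/-- If from every point of `D` the process is outside `D` at time `T` with probability at least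
`δ`, then the expected exit time is at most `T / δ`. -/
theorem lintegral_exitTime_le [IsMarkovKernel P] (hX : IsAssociatedProcess μ p X P) {D : Set E}
    (hD : MeasurableSet D) {T : ℝ≥0} (hT : 0 < T) {δ : ℝ≥0∞} (hδ : δ ≤ 1)
    (h : ∀ z ∈ D, δ ≤ P z (X T ⁻¹' Dᶜ)) (y : E) :
    ∫⁻ ω, exitTime X D ω ∂(P y) ≤ T * δ⁻¹ := by
  -- `S n` includes time `0`, so it contains `n` trials and not `n + 1`. The exit time is at most
  -- `T` times the number of `n` for which `S n` occurs.
  let S : ℕ → Set Ω := fun n => ⋂ k ∈ Finset.range (n + 1), X (k * T) ⁻¹' D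
  have hSmeas : ∀ n, MeasurableSet (S n) := fun n =>
    Finset.measurableSet_biInter _ fun k _ => hX.measurable _ hD
  have hSpast : ∀ n : ℕ, MeasurableSet[⨆ u : Set.Iic (n * T : ℝ≥0),
      MeasurableSpace.comap (X u) inferInstance] (S n) := fun n =>
    Finset.measurableSet_biInter _ fun k hk => measurableSet_past (by
      have : k ≤ n := by simpa [Nat.lt_succ_iff] using hk
      gcongr) hD
  have hSsucc : ∀ n, S (n + 1) = S n ∩ X (n * T + T) ⁻¹' D := fun n => by
    simp only [S]
    rw [Finset.range_add_one, Finset.set_biInter_insert, Set.inter_comm]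
    push_cast
    rw [add_mul, one_mul]
  have hprob : ∀ n, P y (S n) ≤ (1 - δ) ^ n := by
    intro n
    induction n with
    | zero => simpa using prob_le_one
    | succ n ih =>
      rw [hSsucc, hX.markov y (n * T) T _ (hSpast n) D hD]
      calc ∫⁻ ω in S n, P (X (n * T) ω) (X T ⁻¹' D) ∂(P y) ≤ ∫⁻ _ in S n, (1 - δ) ∂(P y) := by
            refine setLIntegral_mono' (hSmeas n) fun ω hω => ?_
            have hz : X (n * T) ω ∈ D := by
              have := Set.mem_iInter₂.1 hω n (by simp)
              exact this
            have h1 := h _ hz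
            rw [Set.preimage_compl, prob_compl_eq_one_sub (hX.measurable T hD)] at h1
            have h2 : P (X (n * T) ω) (X T ⁻¹' D) ≤ 1 := prob_le_one
            calc _ = 1 - (1 - P (X (n * T) ω) (X T ⁻¹' D)) :=
                  (ENNReal.sub_sub_cancel ENNReal.one_ne_top h2).symm
              _ ≤ 1 - δ := by gcongr
        _ = (1 - δ) * P y (S n) := setLIntegral_const _ _
        _ ≤ (1 - δ) * (1 - δ) ^ n := by gcongr
        _ = _ := by rw [pow_succ, mul_comm]
  have hpt : ∀ ω, exitTime X D ω ≤ ∑' n, (S n).indicator (fun _ => (T : ℝ≥0∞)) ω := by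
    intro ω
    by_cases hall : ∀ n, ω ∈ S n
    · have : ∑' n, (S n).indicator (fun _ => (T : ℝ≥0∞)) ω = ⊤ := by
        simp only [Set.indicator_of_mem (hall _)]
        exact ENNReal.tsum_const_eq_top_of_ne_zero (by exact_mod_cast hT.ne')
      rw [this]
      exact le_top
    · push Not at hall
      classical
      have hspec := Nat.find_spec hall
      have hmin : ∀ m < Nat.find hall, ω ∈ S m := fun m hm => not_not.1 (Nat.find_min hall hm)
      set n := Nat.find hall
      have hk : ∃ k, k ≤ n ∧ X (k * T) ω ∉ D := by
        by_contra hcon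
        push Not at hcon
        exact hspec (Set.mem_iInter₂.2 fun k hk =>
          hcon k (by simpa [Nat.lt_succ_iff] using hk))
      obtain ⟨k, hkn, hkD⟩ := hk
      calc exitTime X D ω ≤ ((k * T : ℝ≥0) : ℝ≥0∞) := iInf₂_le (k * T : ℝ≥0) hkD
        _ ≤ ((n * T : ℝ≥0) : ℝ≥0∞) := by
            have : (k : ℝ≥0) ≤ n := by exact_mod_cast hkn
            exact_mod_cast mul_le_mul_left this T
        _ = ∑ m ∈ Finset.range n, (S m).indicator (fun _ => (T : ℝ≥0∞)) ω := by
            rw [Finset.sum_congr rfl fun m hm =>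
              Set.indicator_of_mem (hmin m (Finset.mem_range.1 hm)) _]
            simp
        _ ≤ _ := ENNReal.sum_le_tsum _
  calc ∫⁻ ω, exitTime X D ω ∂(P y)
      ≤ ∫⁻ ω, ∑' n, (S n).indicator (fun _ => (T : ℝ≥0∞)) ω ∂(P y) := lintegral_mono hpt
    _ = ∑' n, ∫⁻ ω, (S n).indicator (fun _ => (T : ℝ≥0∞)) ω ∂(P y) :=
        lintegral_tsum fun n => (measurable_const.indicator (hSmeas n)).aemeasurable
    _ = ∑' n, T * P y (S n) := by simp_rw [lintegral_indicator_const (hSmeas _)]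
    _ ≤ ∑' n, T * (1 - δ) ^ n := ENNReal.tsum_le_tsum fun n => by gcongr; exact hprob n
    _ = T * δ⁻¹ := by
        rw [ENNReal.tsum_mul_left, ENNReal.tsum_geometric,
          ENNReal.sub_sub_cancel ENNReal.one_ne_top hδ]

variable [BorelSpace E]

/-- A maximal inequality: a uniform bound on the probability to be farther than `r / 2` from the
starting point bounds the probability to leave the ball of radius `r`. -/
theorem measure_exists_notMem_closedBall_le [IsMarkovKernel P]
    (hX : IsAssociatedProcess μ p X P) {r : ℝ} {T : ℝ≥0} {b : ℝ≥0∞}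
    (hb : ∀ (z : E) (s : ℝ≥0), 0 < s → s ≤ T → P z {ω | r / 2 < dist z (X s ω)} ≤ b)
    (x : E) (F : Finset ℝ≥0) (hF : ∀ t ∈ F, 0 < t ∧ t < T) :
    P x {ω | ∃ t ∈ F, X t ω ∉ Metric.closedBall x r} ≤ 2 * b := by
  rcases F.eq_empty_or_nonempty with rfl | ⟨t₀, ht₀⟩
  · simp
  have hT : 0 < T := (hF t₀ ht₀).1.trans (hF t₀ ht₀).2
  set A := {ω | ∃ t ∈ F, X t ω ∉ Metric.closedBall x r} with hA
  have hball : MeasurableSet (Metric.closedBall x (r / 2)) :=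
    Metric.isClosed_closedBall.measurableSet
  have hexit := hX.setLIntegral_exit_le x
    (D := Metric.closedBall x r) Metric.isClosed_closedBall.measurableSet
    (h := (Metric.closedBall x (r / 2)).indicator 1) (measurable_one.indicator hball) b
    (G := Set.univ) T F (fun t _ => MeasurableSet.univ) MeasurableSet.univ
    (fun t ht => (hF t ht).2.le) (by
      intro t ht
      -- From an exit position, at distance more than `r` from `x`, a return to the ball of radius
      -- `r / 2` needs a displacement of more than `r / 2`.
      refine Eventually.of_forall fun ω _ hω => ?_
      have hω : r < dist (X t ω) x := by simpa using hω
      have hcomp : (fun ω' => (Metric.closedBall x (r / 2)).indicator (1 : E → ℝ≥0∞)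
          (X (T - t) ω')) = (X (T - t) ⁻¹' Metric.closedBall x (r / 2)).indicator 1 := rfl
      rw [hcomp, lintegral_indicator_one (hX.measurable _ hball)]
      refine (measure_mono fun ω' hω' => ?_).trans
        (hb (X t ω) (T - t) (tsub_pos_of_lt (hF t ht).2) tsub_le_self)
      have h1 : dist (X (T - t) ω') x ≤ r / 2 := hω'
      have h2 := dist_triangle (X t ω) (X (T - t) ω') x
      show r / 2 < dist (X t ω) (X (T - t) ω')
      linarith)
  rw [Set.univ_inter, ← hA] at hexit
  have hcomp : (fun ω' => (Metric.closedBall x (r / 2)).indicator (1 : E → ℝ≥0∞)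
      (X T ω')) = (X T ⁻¹' Metric.closedBall x (r / 2)).indicator 1 := rfl
  rw [hcomp, lintegral_indicator_one (hX.measurable _ hball),
    Measure.restrict_apply (hX.measurable _ hball)] at hexit
  calc P x A ≤ P x ((X T ⁻¹' Metric.closedBall x (r / 2) ∩ A) ∪
          {ω | r / 2 < dist x (X T ω)}) := by
        refine measure_mono fun ω hω => ?_
        by_cases h : dist (X T ω) x ≤ r / 2
        · exact Or.inl ⟨h, hω⟩
        · refine Or.inr ?_
          rw [Set.mem_ofPred_eq, dist_comm]
          exact not_le.1 h
    _ ≤ _ := measure_union_le _ _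
    _ ≤ b * 1 + b := by
        gcongr
        · exact hexit.trans (by gcongr; exact prob_le_one)
        · exact hb x T hT le_rfl
    _ = 2 * b := by rw [mul_one, two_mul]

/-- Right-continuity at time zero. -/
theorem exists_small_time [IsMarkovKernel P] (hX : IsAssociatedProcess μ p X P) (x : E) {η : ℝ}
    (hη : 0 < η) {e : ℝ≥0∞} (he : 0 < e) {t₀ : ℝ≥0} (ht₀ : 0 < t₀) :
    ∃ δ : ℝ≥0, 0 < δ ∧ δ < t₀ ∧ P x (X δ ⁻¹' (Metric.closedBall x η)ᶜ) ≤ e := by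
  have hm : MeasurableSet (Metric.closedBall x η)ᶜ :=
    Metric.isClosed_closedBall.measurableSet.compl
  obtain ⟨u, -, hu0, hu⟩ := exists_seq_strictAnti_tendsto (0 : ℝ≥0)
  have hlim : Tendsto (fun n => ∫⁻ ω, (X (u n) ⁻¹' (Metric.closedBall x η)ᶜ).indicator
      (1 : Ω → ℝ≥0∞) ω ∂(P x)) atTop (𝓝 (∫⁻ _, 0 ∂(P x))) := by
    refine tendsto_lintegral_of_dominated_convergence (fun _ => 1)
      (fun n => measurable_one.indicator (hX.measurable _ hm)) (fun n => ?_) (by simp) ?_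
    · refine Eventually.of_forall fun ω => Set.indicator_le_self' (fun _ _ => zero_le) ω
    · filter_upwards [hX.start x, hX.right_continuous x] with ω h0 hc
      have h1 : Tendsto (fun n => X (u n) ω) atTop (𝓝 x) := by
        have h2 := (hc 0).tendsto
        rw [h0] at h2
        exact h2.comp (tendsto_nhdsWithin_iff.2
          ⟨hu, Eventually.of_forall fun n => Set.mem_Ici.2 zero_le⟩)
      refine tendsto_const_nhds.congr' ?_
      filter_upwards [h1.eventually (Metric.closedBall_mem_nhds x hη)] with n hn
      rw [Set.indicator_of_notMem]
      simpa using hn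
  simp_rw [lintegral_indicator_one (hX.measurable _ hm), lintegral_zero] at hlim
  have h1 := hlim.eventually (Iic_mem_nhds he)
  have h2 := hu.eventually (Iio_mem_nhds ht₀)
  obtain ⟨n, hn1, hn2⟩ := (h1.and h2).exists
  exact ⟨u n, hu0 n, hn2, hn1⟩

end IsAssociatedProcess

/-! ### Exit from balls of radius close to `1`, by symmetry of the semigroup. -/

theorem IsHeatKernel.ae_ae_lintegral_mul {E : Type*} [MeasurableSpace E] {μ : Measure E}
    [SFinite μ] {p : ℝ≥0 → E → E → ℝ≥0} (hp : IsHeatKernel μ p) {s t : ℝ≥0} (hs : 0 < s)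
    (ht : 0 < t) : ∀ᵐ z ∂μ, ∀ᵐ w ∂μ,
      ∫⁻ y, (p s z y : ℝ≥0∞) * ((hp.aemeasurable t ht).mk _ (w, y) : ℝ≥0) ∂μ = p (s + t) z w := by
  -- Symmetry puts `y` in the second slot of both kernels; the jointly measurable version permits
  -- Fubini in `w` and `y` later.
  have hsymm : ∀ᵐ w ∂μ, ∀ᵐ y ∂μ, p t w y = p t y w :=
    Measure.ae_ae_of_ae_prod (hp.symm t ht)
  have hmk : ∀ᵐ w ∂μ, ∀ᵐ y ∂μ, p t w y = (hp.aemeasurable t ht).mk _ (w, y) :=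
    Measure.ae_ae_of_ae_prod (hp.aemeasurable t ht).ae_eq_mk
  filter_upwards [Measure.ae_ae_of_ae_prod (hp.semigroup s t hs ht)] with z hz
  filter_upwards [hz, hsymm, hmk] with w h1 h2 h3
  rw [h1]
  refine lintegral_congr_ae ?_
  filter_upwards [h2, h3] with y h4 h5
  rw [← h5, h4]

namespace IsAssociatedProcess

variable {E Ω : Type*} [MetricSpace E] [MeasurableSpace E] [MeasurableSpace Ω]
  {μ : Measure E} {p : ℝ≥0 → E → E → ℝ≥0} {X : ℝ≥0 → Ω → E} {P : Kernel E Ω}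

/-- On the event `X_δ ∈ U`, the law of `X_T` has the density
`y ↦ E_x[p_{T-δ}(X_δ, y); X_δ ∈ U]`. -/
theorem measure_preimage_inter_eq_setLIntegral [SFinite μ] [IsMarkovKernel P]
    (hp : IsHeatKernel μ p) (hX : IsAssociatedProcess μ p X P) (x : E) {U : Set E}
    (hU : MeasurableSet U) {δ t : ℝ≥0} (hδ : 0 < δ) (ht : 0 < t) {B : Set E}
    (hB : MeasurableSet B) :
    P x (X δ ⁻¹' U ∩ X (δ + t) ⁻¹' B) =
      ∫⁻ y in B, ∫⁻ w, ((hp.aemeasurable t ht).mk _ (w, y) : ℝ≥0)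
        ∂(((P x).restrict (X δ ⁻¹' U)).map (X δ)) ∂μ := by
  set q : E × E → ℝ≥0 := (hp.aemeasurable t ht).mk _ with hq
  have hqm : Measurable q := (hp.aemeasurable t ht).measurable_mk
  have hmk : ∀ᵐ w ∂μ, ∀ᵐ y ∂μ, p t w y = q (w, y) :=
    Measure.ae_ae_of_ae_prod (hp.aemeasurable t ht).ae_eq_mk
  rw [hX.markov x δ t _ (measurableSet_past le_rfl hU) B hB,
    lintegral_lintegral_swap (by fun_prop), lintegral_map (by fun_prop) (hX.measurable δ)]
  refine lintegral_congr_ae (ae_restrict_of_ae ?_)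
  filter_upwards [hX.ae_comp hδ x hmk] with ω hω
  rw [hX.transition t ht _ B hB]
  refine lintegral_congr_ae (ae_restrict_of_ae ?_)
  filter_upwards [hω] with y hy
  rw [hy]

variable [BorelSpace E]

/-- Bound for the probability to leave a ball of radius `r > 1` up to time `T`, in terms of an
upper bound `κ` of the heat kernel at distances exceeding `1`. -/
theorem measure_exists_notMem_closedBall_le_of_kernel_le [SFinite μ] [IsMarkovKernel P]
    (hp : IsHeatKernel μ p) (hX : IsAssociatedProcess μ p X P) {r : ℝ} (hr : 1 < r) {T : ℝ≥0}
    {κ k : ℝ≥0∞} (hk0 : k ≠ 0) (hktop : k ≠ ⊤)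
    (hκ : ∀ s : ℝ≥0, 0 < s → s ≤ 2 * T → ∀ z w, 1 < dist z w → (p s z w : ℝ≥0∞) ≤ κ)
    (x : E) {B : Set E} (hB : MeasurableSet B) {e : ℝ≥0∞} (he : 0 < e)
    (F : Finset ℝ≥0) (hF : ∀ t ∈ F, 0 < t ∧ t < T) :
    P x {ω | ∃ t ∈ F, X t ω ∉ Metric.closedBall x r} ≤
      k * μ B + κ / k + P x (X T ⁻¹' Bᶜ) + e := by
  rcases F.eq_empty_or_nonempty with rfl | hne
  · simp
  have hmin := hF _ (F.min'_mem hne)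
  obtain ⟨δ, hδ, hδF, hδe⟩ := hX.exists_small_time x (sub_pos.2 hr) he hmin.1
  have hδT : δ < T := hδF.trans hmin.2
  have hlt : ∀ t ∈ F, δ < t := fun t ht => hδF.trans_le (F.min'_le t ht)
  set U := Metric.closedBall x (r - 1) with hUdef
  have hU : MeasurableSet U := Metric.isClosed_closedBall.measurableSet
  have hTδ : 0 < T - δ := tsub_pos_of_lt hδT
  set q : E × E → ℝ≥0 := (hp.aemeasurable (T - δ) hTδ).mk _ with hq
  have hqm : Measurable q := (hp.aemeasurable (T - δ) hTδ).measurable_mk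
  set G := X δ ⁻¹' U with hG
  have hGm : MeasurableSet G := hX.measurable δ hU
  set l := ((P x).restrict G).map (X δ) with hl
  -- Because `δ > 0`, the law of `X_δ` does not charge the null set on which the semigroup identity
  -- may fail; the same holds for `X_t`, `t ∈ F`.
  have hlac : l ≪ μ := by
    refine (Measure.map_mono Measure.restrict_le_self
      (hX.measurable δ)).absolutelyContinuous.trans ?_
    rw [hX.map_eq_withDensity hδ x]
    exact withDensity_absolutelyContinuous _ _
  have hlU : ∀ᵐ w ∂l, w ∈ U := by
    exact (ae_map_iff (p := (· ∈ U)) (hX.measurable δ).aemeasurable hU).2 (ae_restrict_mem hGm)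
  have hl1 : l Set.univ ≤ 1 := by
    rw [hl, Measure.map_apply (hX.measurable δ) MeasurableSet.univ]
    exact (Measure.restrict_apply_le _ _).trans prob_le_one
  set g : E → ℝ≥0∞ := fun y => ∫⁻ w, (q (w, y) : ℝ≥0∞) ∂l with hg
  have hgm : Measurable g := by
    refine Measurable.lintegral_prod_left' (f := fun z : E × E => (q z : ℝ≥0∞)) (by fun_prop)
  have hdens : ∀ C : Set E, MeasurableSet C → P x (G ∩ X T ⁻¹' C) = ∫⁻ y in C, g y ∂μ := by
    intro C hC
    have := hX.measure_preimage_inter_eq_setLIntegral hp x hU hδ hTδ hC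
    rwa [add_tsub_cancel_of_le hδT.le] at this
  set A := G ∩ {ω | ∃ t ∈ F, X t ω ∉ Metric.closedBall x r} with hA
  -- After an exit at `z = X_t`, the expectation of `g` is the `l`-average over `w` of
  -- `p_{(T-t)+(T-δ)}(z, w)`. Here `d(z, w) > r - (r - 1) = 1`, so `κ` applies.
  have hexit : ∫⁻ ω in A, g (X T ω) ∂(P x) ≤ κ * P x A := by
    refine hX.setLIntegral_exit_le x Metric.isClosed_closedBall.measurableSet hgm κ T F
      (fun t ht => measurableSet_past (hlt t ht).le hU) hGm (fun t ht => (hF t ht).2.le) ?_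
    intro t ht
    have htT : 0 < T - t := tsub_pos_of_lt (hF t ht).2
    filter_upwards [hX.ae_comp (hF t ht).1 x (hp.ae_ae_lintegral_mul htT hTδ)] with ω hω _ hωD
    have hωD : r < dist (X t ω) x := by simpa using hωD
    rw [← lintegral_map hgm (hX.measurable _), hX.map_eq_withDensity htT,
      lintegral_lintegral_swap (by fun_prop)]
    calc ∫⁻ w, ∫⁻ y, (q (w, y) : ℝ≥0∞)
          ∂(μ.withDensity fun y => (p (T - t) (X t ω) y : ℝ≥0∞)) ∂l
        ≤ ∫⁻ _, κ ∂l := by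
          refine lintegral_mono_ae ?_
          filter_upwards [hlac.ae_le hω, hlU] with w hw hwU
          rw [lintegral_withDensity_eq_lintegral_mul₀
            (hX.aemeasurable_density _ htT _).coe_nnreal_ennreal (by fun_prop)]
          simp only [Pi.mul_apply]
          rw [hw]
          refine hκ _ (by positivity) ?_ _ _ ?_
          · rw [two_mul]
            exact add_le_add tsub_le_self tsub_le_self
          · have h1 : dist w x ≤ r - 1 := hwU
            have h2 := dist_triangle (X t ω) w x
            linarith
      _ = κ * l Set.univ := lintegral_const _
      _ ≤ κ * 1 := by gcongr
      _ = κ := mul_one _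
  -- On `G` the law of `X_T` has density `g`, so low values of `g` carry little mass in `B`.
  have hlow : P x (G ∩ X T ⁻¹' (B ∩ {y | g y < k})) ≤ k * μ B := by
    rw [hdens _ (hB.inter (measurableSet_lt hgm measurable_const))]
    calc ∫⁻ y in B ∩ {y | g y < k}, g y ∂μ ≤ ∫⁻ _ in B ∩ {y | g y < k}, k ∂μ :=
          setLIntegral_mono measurable_const fun y hy => le_of_lt hy.2
      _ = k * μ (B ∩ {y | g y < k}) := setLIntegral_const _ _
      _ ≤ k * μ B := by gcongr; exact Set.inter_subset_left
  have hhigh : P x (A ∩ {ω | k ≤ g (X T ω)}) ≤ κ / k := by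
    have hm : MeasurableSet {ω | k ≤ g (X T ω)} :=
      measurableSet_le measurable_const (hgm.comp (hX.measurable T))
    rw [Set.inter_comm, ← Measure.restrict_apply hm, ENNReal.le_div_iff_mul_le (.inl hk0)
      (.inl hktop), mul_comm]
    refine (mul_meas_ge_le_lintegral (hgm.comp (hX.measurable T)) k).trans (hexit.trans ?_)
    exact mul_le_of_le_one_right zero_le prob_le_one
  have hcover : {ω | ∃ t ∈ F, X t ω ∉ Metric.closedBall x r} ⊆
      (((G ∩ X T ⁻¹' (B ∩ {y | g y < k})) ∪ (A ∩ {ω | k ≤ g (X T ω)})) ∪ X T ⁻¹' Bᶜ) ∪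
        X δ ⁻¹' Uᶜ := by
    intro ω hω
    by_cases h1 : ω ∈ G
    · by_cases h2 : X T ω ∈ B
      · by_cases h3 : g (X T ω) < k
        · exact .inl (.inl (.inl ⟨h1, h2, h3⟩))
        · exact .inl (.inl (.inr ⟨⟨h1, hω⟩, not_lt.1 h3⟩))
      · exact .inl (.inr h2)
    · exact .inr h1
  refine (measure_mono hcover).trans ((measure_union_le _ _).trans ?_)
  refine add_le_add ((measure_union_le _ _).trans ?_) hδe
  exact add_le_add ((measure_union_le _ _).trans (add_le_add hlow hhigh)) le_rfl

end IsAssociatedProcess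

/-! ### σ-finiteness and translation of `Comparable` into one-sided bounds. -/

theorem sigmaFinite_of_measure_closedBall {E : Type*} [PseudoMetricSpace E] [MeasurableSpace E]
    {μ : Measure E} (x : E) {V : ℝ → ℝ≥0}
    (hV : ∀ r : ℝ, 0 < r → μ (Metric.closedBall x r) = (V r : ℝ≥0∞)) : SigmaFinite μ :=
  ⟨⟨{ set := fun n : ℕ => Metric.closedBall x (n + 1)
      set_mem := fun _ => trivial
      finite := fun n => by rw [hV _ (by positivity)]; exact ENNReal.coe_lt_top
      spanning := by
        refine Set.eq_univ_of_forall fun y => Set.mem_iUnion.2 ?_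
        obtain ⟨n, hn⟩ := exists_nat_ge (dist y x)
        exact ⟨n, by rw [Metric.mem_closedBall]; linarith⟩ }⟩⟩

/-- The conventions for division in `ℝ≥0∞` make the two strict bounds exclude `b = 0`: `0 / 0 = 0`
violates the lower one, `a / 0 = ⊤` the upper one. -/
theorem Comparable.pos_and_le {c : ℝ≥0} {a b : ℝ≥0} (h₁ : (c : ℝ≥0∞)⁻¹ < (a : ℝ≥0∞) / b)
    (h₂ : (a : ℝ≥0∞) / b < c) : 0 < b ∧ (a : ℝ) ≤ c * b := by
  have hb : b ≠ 0 := by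
    rintro rfl
    by_cases ha : a = 0
    · simp [ha] at h₁
    · rw [ENNReal.coe_zero, ENNReal.div_zero (by exact_mod_cast ha)] at h₂
      exact not_top_lt h₂
  refine ⟨pos_iff_ne_zero.2 hb, ?_⟩
  have h := (ENNReal.div_le_iff (by exact_mod_cast hb) ENNReal.coe_ne_top).1 h₂.le
  exact_mod_cast h

theorem Comparable.ofReal_le_and_le_ofReal {c : ℝ≥0} (hc : 0 < c) {f : ℝ≥0∞} {g : ℝ} (hg : 0 < g)
    (h₁ : (c : ℝ≥0∞)⁻¹ < f / ENNReal.ofReal g) (h₂ : f / ENNReal.ofReal g < c) :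
    ENNReal.ofReal ((c : ℝ)⁻¹ * g) ≤ f ∧ f ≤ ENNReal.ofReal (c * g) := by
  have hg0 : ENNReal.ofReal g ≠ 0 := by simpa using hg
  constructor
  · rw [ENNReal.ofReal_mul (by positivity), ENNReal.ofReal_inv_of_pos (x := (c : ℝ)) hc,
      ENNReal.ofReal_coe_nnreal]
    exact (ENNReal.le_div_iff_mul_le (.inl hg0) (.inl ENNReal.ofReal_ne_top)).1 h₁.le
  · rw [ENNReal.ofReal_mul (by positivity), ENNReal.ofReal_coe_nnreal]
    exact (ENNReal.div_le_iff hg0 ENNReal.ofReal_ne_top).1 h₂.le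

theorem Comparable.of_ofReal_le {ι : Type*} {s : Set ι} {f : ι → ℝ≥0∞} {g : ι → ℝ}
    (hg : ∀ i ∈ s, 0 < g i) {m M : ℝ} (hm : 0 < m) (hM : 0 < M)
    (h₁ : ∀ i ∈ s, ENNReal.ofReal (m * g i) ≤ f i)
    (h₂ : ∀ i ∈ s, f i ≤ ENNReal.ofReal (M * g i)) :
    Comparable s f (fun i => ENNReal.ofReal (g i)) := by
  have hc : 0 < m⁻¹ + M := by positivity
  -- The sum, unlike the maximum, exceeds both `m⁻¹` and `M` strictly.
  refine ⟨(m⁻¹ + M).toNNReal, by simpa using hc, fun i hi => ?_⟩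
  have hg0 : ENNReal.ofReal (g i) ≠ 0 := by simpa using hg i hi
  have hcoe : (((m⁻¹ + M).toNNReal : ℝ≥0) : ℝ≥0∞) = ENNReal.ofReal (m⁻¹ + M) := rfl
  have hmi : 0 < m⁻¹ := by positivity
  rw [hcoe]
  constructor
  · calc (ENNReal.ofReal (m⁻¹ + M))⁻¹ < ENNReal.ofReal m := by
          rw [← ENNReal.ofReal_inv_of_pos hc, ENNReal.ofReal_lt_ofReal_iff hm]
          exact inv_lt_of_inv_lt₀ hm (by linarith)
      _ ≤ _ := by
          rw [ENNReal.le_div_iff_mul_le (.inl hg0) (.inl ENNReal.ofReal_ne_top),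
            ← ENNReal.ofReal_mul hm.le]
          exact h₁ i hi
  · calc f i / ENNReal.ofReal (g i) ≤ ENNReal.ofReal M := by
          rw [ENNReal.div_le_iff hg0 ENNReal.ofReal_ne_top, ← ENNReal.ofReal_mul hM.le]
          exact h₂ i hi
      _ < _ := by
          rw [ENNReal.ofReal_lt_ofReal_iff hc]
          linarith

/-! ### Lower bounds for expected exit times. -/

namespace IsAssociatedProcess

variable {E Ω : Type*} [MetricSpace E] [MeasurableSpace E] [BorelSpace E] [MeasurableSpace Ω]
  {μ : Measure E} {p : ℝ≥0 → E → E → ℝ≥0} {X : ℝ≥0 → Ω → E} {P : Kernel E Ω}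
  {V : ℝ → ℝ≥0} {α K : ℝ}

/-- Expected exit times from balls of large radius, given polynomial tails of the position. -/
theorem exists_le_lintegral_exitTime_of_two_lt [IsMarkovKernel P]
    (hX : IsAssociatedProcess μ p X P) {C : ℝ} (hC : 0 < C)
    (htail : ∀ (y : E) (s : ℝ≥0) (R : ℝ), 0 < s → 1 ≤ R →
      P y {ω | R < dist y (X s ω)} ≤ ENNReal.ofReal (C * s * R ^ (-(α / 2)))) :
    ∃ m : ℝ, 0 < m ∧ ∀ (x : E) (r : ℝ), 2 < r →
      ENNReal.ofReal (m * r ^ (α / 2)) ≤ ∫⁻ ω, exitTime X (Metric.closedBall x r) ω ∂(P x) := by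
  -- Chosen to make the tail bound at radius `r / 2` and time `ε * r ^ (α / 2)` equal to `1 / 4`.
  -- The tail bound needs `r / 2 ≥ 1`.
  set ε : ℝ := (4 * C * 2 ^ (α / 2))⁻¹ with hε
  have hεpos : 0 < ε := by positivity
  refine ⟨ε * 2⁻¹, by positivity, fun x r hr => ?_⟩
  have hr0 : 0 < r := by linarith
  set T : ℝ≥0 := (ε * r ^ (α / 2)).toNNReal with hT
  have hTr : (T : ℝ) = ε * r ^ (α / 2) := Real.coe_toNNReal _ (by positivity)
  have hb : ∀ (z : E) (s : ℝ≥0), 0 < s → s ≤ T →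
      P z {ω | r / 2 < dist z (X s ω)} ≤ ENNReal.ofReal (1 / 4) := by
    intro z s hs hsT
    refine (htail z s (r / 2) hs (by linarith)).trans (ENNReal.ofReal_le_ofReal ?_)
    calc C * s * (r / 2) ^ (-(α / 2)) ≤ C * T * (r / 2) ^ (-(α / 2)) := by
          gcongr
      _ = 1 / 4 := by
          rw [hTr, hε, Real.rpow_neg (by positivity), Real.div_rpow hr0.le (by norm_num)]
          field_simp
  have hexit := hX.exitTime_lt_le x (D := Metric.closedBall x r) Metric.isClosed_closedBall T
    (2⁻¹) fun F hF => (hX.measure_exists_notMem_closedBall_le hb x F hF).trans (by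
      rw [show (2 : ℝ≥0∞) = ENNReal.ofReal 2 by simp, ← ENNReal.ofReal_mul (by norm_num),
        ← ENNReal.ofReal_inv_of_pos (by norm_num)]
      exact ENNReal.ofReal_le_ofReal (by norm_num))
  refine le_trans (le_of_eq ?_) (le_lintegral_of_measure_lt _ _ _ hexit)
  rw [← ENNReal.ofReal_coe_nnreal, hTr, show (2 : ℝ≥0∞) = ENNReal.ofReal 2 by simp,
    ← ENNReal.ofReal_inv_of_pos (by norm_num), ← ENNReal.ofReal_mul (by positivity)]
  congr 1
  ring

/-- Expected exit times from balls of radius between `1` and `2`. -/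
theorem exists_le_lintegral_exitTime_of_le_two [IsMarkovKernel P] [SFinite μ]
    (hp : IsHeatKernel μ p) (hX : IsAssociatedProcess μ p X P) (hα : 0 < α)
    (hV : ∀ x : E, ∀ r : ℝ, 0 < r → μ (Metric.closedBall x r) = (V r : ℝ≥0∞))
    (hpos : ∀ r, 1 ≤ r → 0 < V r) (hmono : ∀ r s, 0 < r → r ≤ s → V r ≤ V s) (hK : 0 < K)
    (hup : ∀ t : ℝ≥0, 0 < t → ∀ y z : E, (t : ℝ) ^ (2 / α) < dist y z → 1 < dist y z →
      (p t y z : ℝ≥0∞) ≤ ENNReal.ofReal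
        (K * ((t : ℝ) * dist y z ^ (-1 - α / 2) * (V (dist y z) : ℝ)⁻¹)))
    {C : ℝ} (hC : 0 < C)
    (htail : ∀ (y : E) (s : ℝ≥0) (R : ℝ), 0 < s → 1 ≤ R →
      P y {ω | R < dist y (X s ω)} ≤ ENNReal.ofReal (C * s * R ^ (-(α / 2)))) :
    ∃ m : ℝ, 0 < m ∧ ∀ (x : E) (r : ℝ), 1 < r → r ≤ 2 →
      ENNReal.ofReal (m * r ^ (α / 2)) ≤ ∫⁻ ω, exitTime X (Metric.closedBall x r) ω ∂(P x) := by
  have hV1 : (0 : ℝ) < V 1 := by exact_mod_cast hpos 1 le_rfl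
  have hV2 : (0 : ℝ) < V 2 := by exact_mod_cast hpos 2 (by norm_num)
  -- The first bound keeps `s ≤ 2 * T₀ ≤ 1`, so the kernel estimate holds at all distances above
  -- `1`. The others make `κ / k` and the tail at `2` at most `1 / 8`. With `k * μ B = 1 / 8` and `e
  -- = 1 / 8` the four terms add up to at most `1 / 2`.
  set T₀ : ℝ := min (1 / 2) (min (V 1 / (128 * K * V 2)) (1 / (8 * C))) with hT₀
  have hT₀pos : 0 < T₀ := by positivity
  have hT₀1 : T₀ ≤ 1 / 2 := min_le_left _ _
  have hT₀2 : T₀ ≤ V 1 / (128 * K * V 2) := (min_le_right _ _).trans (min_le_left _ _)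
  have hT₀3 : T₀ ≤ 1 / (8 * C) := (min_le_right _ _).trans (min_le_right _ _)
  set T : ℝ≥0 := T₀.toNNReal with hT
  have hTr : (T : ℝ) = T₀ := Real.coe_toNNReal _ hT₀pos.le
  have hTpos : 0 < T := by simpa [hT] using hT₀pos
  refine ⟨T₀ * 2⁻¹ * (2 ^ (α / 2))⁻¹, by positivity, fun x r hr hr2 => ?_⟩
  have hκ : ∀ s : ℝ≥0, 0 < s → s ≤ 2 * T → ∀ z w, 1 < dist z w →
      (p s z w : ℝ≥0∞) ≤ ENNReal.ofReal (K * (2 * T₀) * (V 1 : ℝ)⁻¹) := by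
    intro s hs hsT z w hzw
    have hsT' : (s : ℝ) ≤ 2 * T₀ := by rw [← hTr]; exact_mod_cast hsT
    have h1 : (s : ℝ) ^ (2 / α) ≤ 1 := Real.rpow_le_one s.2 (by linarith) (by positivity)
    refine (hup s hs z w (by linarith) hzw).trans (ENNReal.ofReal_le_ofReal ?_)
    have h2 : dist z w ^ (-1 - α / 2) ≤ 1 :=
      Real.rpow_le_one_of_one_le_of_nonpos hzw.le (by linarith)
    have h3 : (V 1 : ℝ) ≤ V (dist z w) := by exact_mod_cast hmono _ _ one_pos hzw.le
    calc K * ((s : ℝ) * dist z w ^ (-1 - α / 2) * (V (dist z w) : ℝ)⁻¹)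
        ≤ K * ((2 * T₀) * 1 * (V 1 : ℝ)⁻¹) := by gcongr
      _ = _ := by ring
  have hk : 0 < 1 / (8 * (V 2 : ℝ)) := by positivity
  have h8 : (0 : ℝ) ≤ 1 / 8 := by norm_num
  have hexit := hX.exitTime_lt_le x (D := Metric.closedBall x r) Metric.isClosed_closedBall T
    (2⁻¹) fun F hF => (hX.measure_exists_notMem_closedBall_le_of_kernel_le hp hr
      (k := ENNReal.ofReal (1 / (8 * (V 2 : ℝ)))) (by simpa using hk) ENNReal.ofReal_ne_top hκ x
      (B := Metric.closedBall x 2) Metric.isClosed_closedBall.measurableSet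
      (e := ENNReal.ofReal (1 / 8)) (by simp) F hF).trans (by
      have e1 : ENNReal.ofReal (1 / (8 * (V 2 : ℝ))) * μ (Metric.closedBall x 2) =
          ENNReal.ofReal (1 / 8) := by
        rw [hV x 2 (by norm_num), ← ENNReal.ofReal_coe_nnreal, ← ENNReal.ofReal_mul hk.le]
        congr 1
        field_simp
      have e2 : ENNReal.ofReal (K * (2 * T₀) * (V 1 : ℝ)⁻¹) /
          ENNReal.ofReal (1 / (8 * (V 2 : ℝ))) ≤ ENNReal.ofReal (1 / 8) := by
        rw [← ENNReal.ofReal_div_of_pos hk]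
        refine ENNReal.ofReal_le_ofReal ?_
        rw [le_div_iff₀ (by positivity)] at hT₀2
        rw [div_le_iff₀ hk, ← div_eq_mul_inv, div_le_iff₀ hV1,
          show 1 / 8 * (1 / (8 * (V 2 : ℝ))) * V 1 = V 1 / (64 * V 2) by field_simp; norm_num,
          le_div_iff₀ (by positivity)]
        linarith
      have e3 : P x (X T ⁻¹' (Metric.closedBall x 2)ᶜ) ≤ ENNReal.ofReal (1 / 8) := by
        have hset : X T ⁻¹' (Metric.closedBall x 2)ᶜ = {ω | 2 < dist x (X T ω)} := by
          ext ω
          simp [dist_comm]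
        rw [hset]
        refine (htail x T 2 hTpos (by norm_num)).trans (ENNReal.ofReal_le_ofReal ?_)
        have h2 : (2 : ℝ) ^ (-(α / 2)) ≤ 1 :=
          Real.rpow_le_one_of_one_le_of_nonpos (by norm_num) (by linarith)
        rw [le_div_iff₀ (by positivity)] at hT₀3
        calc C * T * 2 ^ (-(α / 2)) ≤ C * T * 1 := by gcongr
          _ ≤ 1 / 8 := by rw [hTr]; linarith
      rw [e1]
      refine (add_le_add (add_le_add (add_le_add le_rfl e2) e3) le_rfl).trans ?_
      rw [← ENNReal.ofReal_add h8 h8, ← ENNReal.ofReal_add (by norm_num) h8,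
        ← ENNReal.ofReal_add (by norm_num) h8, show (2 : ℝ≥0∞) = ENNReal.ofReal 2 by simp,
        ← ENNReal.ofReal_inv_of_pos (by norm_num)]
      exact ENNReal.ofReal_le_ofReal (by norm_num))
  refine le_trans ?_ (le_lintegral_of_measure_lt _ _ _ hexit)
  rw [← ENNReal.ofReal_coe_nnreal, hTr, show (2 : ℝ≥0∞) = ENNReal.ofReal 2 by simp,
    ← ENNReal.ofReal_inv_of_pos (by norm_num), ← ENNReal.ofReal_mul hT₀pos.le]
  refine ENNReal.ofReal_le_ofReal ?_
  have h1 : r ^ (α / 2) ≤ 2 ^ (α / 2) := by gcongr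
  calc T₀ * 2⁻¹ * (2 ^ (α / 2))⁻¹ * r ^ (α / 2)
      ≤ T₀ * 2⁻¹ * (2 ^ (α / 2))⁻¹ * 2 ^ (α / 2) := by gcongr
    _ = T₀ * 2⁻¹ := by field_simp

end IsAssociatedProcess

/-! ### Assembly of the two bounds. -/

theorem theorem4p3 {E Ω : Type*} [MetricSpace E] [MeasurableSpace E] [BorelSpace E]
    [MeasurableSpace Ω] (α : ℝ) (hα : 0 < α ∧ α < 2)
    (μ : Measure E) (p : ℝ≥0 → E → E → ℝ≥0) (hp : IsHeatKernel μ p)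
    (X : ℝ≥0 → Ω → E) (P : Kernel E Ω) [IsMarkovKernel P] (hX : IsAssociatedProcess μ p X P)
    (V : ℝ → ℝ≥0) (hV : ∀ x : E, ∀ r : ℝ, 0 < r → μ (Metric.closedBall x r) = (V r : ℝ≥0∞))
    (hvol₁ : ∃ A : ℝ, 1 ≤ A ∧ ∃ c₁ : ℝ, c₁ < 1 ∧
      ∀ r : ℝ, 1 ≤ r → (V r : ℝ) ≤ c₁ * (V (r + A) : ℝ))
    (hvol₂ : Comparable {r : ℝ | 1 ≤ r}
      (fun r => (V (r + 1) : ℝ≥0∞)) (fun r => (V r : ℝ≥0∞)))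
    (hptx : ∀ M : ℝ, 0 < M → Comparable
      {i : ℝ≥0 × E × E | 0 < i.1 ∧ M * (i.1 : ℝ) ^ (2 / α) < dist i.2.1 i.2.2 ∧
        1 < dist i.2.1 i.2.2}
      (fun i => (p i.1 i.2.1 i.2.2 : ℝ≥0∞))
      (fun i => ENNReal.ofReal ((i.1 : ℝ) * dist i.2.1 i.2.2 ^ (-1 - α / 2) *
        (V (dist i.2.1 i.2.2) : ℝ)⁻¹))) :
    (∃ c : ℝ, 0 < c ∧ ∀ r : ℝ, 1 < r → ∀ x : E, ∀ y ∈ Metric.closedBall x r,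
      ∫⁻ ω, exitTime X (Metric.closedBall x r) ω ∂(P y) ≤ ENNReal.ofReal (c * r ^ (α / 2))) ∧
    Comparable {i : E × ℝ | 1 < i.2}
      (fun i => ∫⁻ ω, exitTime X (Metric.closedBall i.1 i.2) ω ∂(P i.1))
      (fun i => ENNReal.ofReal (i.2 ^ (α / 2))) := by
  obtain ⟨hα, -⟩ := hα
  rcases isEmpty_or_nonempty E with hE | ⟨⟨x₀⟩⟩
  · exact ⟨⟨1, one_pos, fun r _ x => hE.elim x⟩, 1, one_pos, fun i _ => hE.elim i.1⟩
  have : SigmaFinite μ := sigmaFinite_of_measure_closedBall x₀ (hV x₀)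
  obtain ⟨A, hA, c₁, hc₁, hgrow⟩ := hvol₁
  obtain ⟨Cv, hCv, hvol⟩ := hvol₂
  have hpos : ∀ r, 1 ≤ r → 0 < V r := fun r hr =>
    (Comparable.pos_and_le (hvol r hr).1 (hvol r hr).2).1
  have hdoub : ∀ r, 1 ≤ r → (V (r + 1) : ℝ) ≤ Cv * V r := fun r hr =>
    (Comparable.pos_and_le (hvol r hr).1 (hvol r hr).2).2
  have hmono : ∀ r s, 0 < r → r ≤ s → V r ≤ V s := by
    intro r s hr hrs
    have h := measure_mono (μ := μ) (Metric.closedBall_subset_closedBall (x := x₀) hrs)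
    rw [hV _ _ hr, hV _ _ (hr.trans_le hrs)] at h
    exact_mod_cast h
  -- The single value `M = 1` suffices for both kernel bounds.
  obtain ⟨K, hK, hker⟩ := hptx 1 one_pos
  have hK' : (0 : ℝ) < K := hK
  have hbounds : ∀ t : ℝ≥0, 0 < t → ∀ y z : E, (t : ℝ) ^ (2 / α) < dist y z → 1 < dist y z →
      ENNReal.ofReal ((K : ℝ)⁻¹ * ((t : ℝ) * dist y z ^ (-1 - α / 2) * (V (dist y z) : ℝ)⁻¹)) ≤
        (p t y z : ℝ≥0∞) ∧ (p t y z : ℝ≥0∞) ≤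
        ENNReal.ofReal (K * ((t : ℝ) * dist y z ^ (-1 - α / 2) * (V (dist y z) : ℝ)⁻¹)) := by
    intro t ht y z h1 h2
    have h := hker (t, y, z) ⟨ht, by simpa using h1, h2⟩
    have hVd : (0 : ℝ) < V (dist y z) := by exact_mod_cast hpos _ h2.le
    have ht' : (0 : ℝ) < t := ht
    have hd : 0 < dist y z := by linarith
    exact Comparable.ofReal_le_and_le_ofReal hK (by positivity) h.1 h.2
  have hup := fun t ht y z h1 h2 => (hbounds t ht y z h1 h2).2
  have hlow := fun t ht y z h1 h2 => (hbounds t ht y z h1 h2).1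
  obtain ⟨C, hC, htail⟩ := hX.measure_dist_gt_le hα hV hpos hmono hCv hdoub hK' hup
  obtain ⟨δ, hδ, hesc⟩ := hX.le_measure_dist_gt hα hV hpos hmono hA hc₁ hgrow (inv_pos.2 hK') hlow
  obtain ⟨m₁, hm₁, hlarge⟩ := hX.exists_le_lintegral_exitTime_of_two_lt hC htail
  obtain ⟨m₂, hm₂, hsmall⟩ :=
    hX.exists_le_lintegral_exitTime_of_le_two hp hα hV hpos hmono hK' hup hC htail
  have hupper : ∀ r : ℝ, 1 < r → ∀ x : E, ∀ y : E,
      ∫⁻ ω, exitTime X (Metric.closedBall x r) ω ∂(P y) ≤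
        ENNReal.ofReal (δ⁻¹ * r ^ (α / 2)) := by
    intro r hr x y
    have hr0 : 0 < r := by linarith
    have hT : 0 < r ^ (α / 2) := by positivity
    have hTr : ((r ^ (α / 2)).toNNReal : ℝ) = r ^ (α / 2) := Real.coe_toNNReal _ hT.le
    have hδ1 : ENNReal.ofReal δ ≤ 1 := (hesc x _ r hr hTr).trans prob_le_one
    refine (hX.lintegral_exitTime_le Metric.isClosed_closedBall.measurableSet
      (Real.toNNReal_pos.2 hT) hδ1 (fun z hz => ?_) y).trans (le_of_eq ?_)
    -- Two points of a ball of radius `r` are at distance at most `2 * r`.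
    · refine (hesc z _ r hr hTr).trans (measure_mono fun ω hω hmem => ?_)
      have h1 : dist z x ≤ r := hz
      have h2 : dist (X (r ^ (α / 2)).toNNReal ω) x ≤ r := hmem
      have h3 : 2 * r < dist z (X (r ^ (α / 2)).toNNReal ω) := hω
      have h4 := dist_triangle_right z (X (r ^ (α / 2)).toNNReal ω) x
      linarith
    · rw [← ENNReal.ofReal_inv_of_pos hδ, mul_comm, ENNReal.ofReal_mul (by positivity)]
      rfl
  refine ⟨⟨δ⁻¹, inv_pos.2 hδ, fun r hr x y _ => hupper r hr x y⟩, ?_⟩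
  refine Comparable.of_ofReal_le (m := min m₁ m₂) (M := δ⁻¹) (fun i hi => ?_) (lt_min hm₁ hm₂)
    (inv_pos.2 hδ) (fun i hi => ?_) (fun i hi => hupper _ hi _ _)
  · have : (0 : ℝ) < i.2 := one_pos.trans hi
    positivity
  · have : (0 : ℝ) < i.2 := one_pos.trans hi
    rcases lt_or_ge 2 i.2 with h | h
    · refine le_trans (ENNReal.ofReal_le_ofReal ?_) (hlarge i.1 i.2 h)
      gcongr
      exact min_le_left _ _
    · refine le_trans (ENNReal.ofReal_le_ofReal ?_) (hsmall i.1 i.2 hi h)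
      gcongr
      exact min_le_right _ _
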